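/- All $C^*$-algebras and their morphisms are unital (the zero algebra is allowed). Let $\mathbb T\rtimes\mathbb Z_2$ be the semidirect product of the circle group by the conjugation action of $\mathbb Z_2$, and let $\tau$ be the generator of $\mathbb Z_2$. Let $Z$ be a compact Hausdorff space with a continuous action of $\mathbb T\rtimes\mathbb Z_2$ such that the action of $\mathbb T$ is free. Put $$Z_{\mathbb R}=\{z\in Z : \tau z=z\},\qquad Z_{\rm reg}=Z\setminus \mathbb T Z_{\mathbb R}.$$ Let $C(Z)\rtimes\mathbb Z_2$ be the crossed product $C^*$-algebra, with elements $f_0\otimes 1+f_1\otimes\tau$ ($f_0,f_1\in C(Z)$), and let $$C(Z_{\mathbb R,*})=\{f_0\otimes 1+f_1\otimes\tau : f_0(\omega z)=f_0(z),\ f_1(\omega z)=\omega f_1(z)\ \ \forall \omega\in\mathbb T,\ z\in Z\}\subset C(Z)\rtimes\mathbb Z_2 ,$$ which is a $C^*$-subalgebra. A quantum subspace $X\subset Z_{\mathbb R,*}$ is a surjective $*$-homomorphism $q: C(Z_{\mathbb R,*})\to C(X)$ onto a $C^*$-algebra $C(X)$, up to isomorphism of the targets compatible with the maps from $C(Z_{\mathbb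 R,*})$. It is called non-classical if $C(X)$ is non-commutative. For $z \in Z$ let $\theta_z: C(Z_{\mathbb R,*})\to M_2(\mathbb C)$, $\theta_z(f_0\otimes 1+f_1\otimes\tau)=\begin{pmatrix} f_0(z)& f_1(z)\\ f_1(\tau z)& f_0(\tau z)\end{pmatrix}$, and for $z\in Z_{\mathbb R}$ let $\phi_z:C(Z_{\mathbb R,*})\to\mathbb C$, $\phi_z(f_0\otimes 1+f_1\otimes\tau)=f_0(z)+f_1(z)$. **Theorem.** There is a bijection between the set of quantum subspaces $X\subset Z_{\mathbb R,*}$ and the set of pairs $(E,F)$ where 1. $E\subset Z_{\rm reg}$ is $\mathbb T\rtimes\mathbb Z_2$-stable and $E=\overline E\cap Z_{\rm reg}$ (that is, $E$ is closed in $Z_{\rm reg}$); 2. $F\subset Z_{\mathbb R}$ is closed and $\overline E\cap Z_{\mathbb R}\subset F$. It sends the quantum subspace given by $q$ to the pair $$E=\{z\in Z_{\rm reg} : \operatorname{Ker} q\subset\operatorname{Ker}\theta_z\},\qquad F=\{z\in Z_{\mathbb R} : \operatorname{Ker} q\subset\operatorname{Ker}\phi_z\}.$$ Moreover $X$ is non-classical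 if and only if, in the corresponding pair $(E,F)$, one has $E\neq\emptyset$. -/

import Mathlib

universe u

noncomputable section

/-- The cyclic group `ℤ₂` of order two, written multiplicatively. -/
abbrev Ztwo : Type := Multiplicative (ZMod 2)

/-- The action of `ℤ₂` on the circle group by automorphisms, whose generator acts by complex
conjugation (that is, by inversion). -/
def circleConj : Ztwo →* MulAut Circle where
  toFun s := if s = 1 then 1 else MulEquiv.inv Circle
  map_one' := by simp
  map_mul' := by
    have h : (MulEquiv.inv Circle : MulAut Circle) * MulEquiv.inv Circle = 1 := by
      ext x; simp
    intro s t
    have hs : s = 1 ∨ s = Multiplicative.ofAdd 1 := by revert s; decide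
    have ht : t = 1 ∨ t = Multiplicative.ofAdd 1 := by revert t; decide
    have h1 : (Multiplicative.ofAdd (1 : ZMod 2)) ≠ 1 := by decide
    have h2 : Multiplicative.ofAdd (1 : ZMod 2) * Multiplicative.ofAdd 1 = 1 := by decide
    rcases hs with rfl | rfl <;> rcases ht with rfl | rfl <;>
      simp only [h1, h2, h, if_true, if_false, mul_one, one_mul]

/-- The semidirect product `𝕋 ⋊ ℤ₂` for the conjugation action. -/
abbrev CircleZtwo : Type := Circle ⋊[circleConj] Ztwo

/-- The topology of `𝕋 ⋊ ℤ₂` is the product topology. -/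
instance : TopologicalSpace CircleZtwo :=
  TopologicalSpace.induced (fun g => (g.left, g.right)) inferInstance

/-- The element `t` of the first factor of `𝕋 ⋊ ℤ₂`. -/
def circleElt (t : Circle) : CircleZtwo := SemidirectProduct.inl t

/-- The generator `τ` of the second factor of `𝕋 ⋊ ℤ₂`. -/
def tauElt : CircleZtwo := SemidirectProduct.inr (Multiplicative.ofAdd 1)

lemma tauElt_mul_self : tauElt * tauElt = 1 := by
  unfold tauElt
  rw [← map_mul, show Multiplicative.ofAdd (1 : ZMod 2) * Multiplicative.ofAdd 1 = 1 by decide,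
    map_one]

lemma circleConj_gen (t : Circle) : circleConj (Multiplicative.ofAdd 1) t = t⁻¹ := by
  have h1 : (Multiplicative.ofAdd (1 : ZMod 2)) ≠ 1 := by decide
  simp [circleConj, h1]

lemma circleElt_conj (t : Circle) : tauElt * circleElt t = circleElt t⁻¹ * tauElt := by
  apply SemidirectProduct.ext <;> simp [tauElt, circleElt, circleConj_gen]

section Points

variable (Z : Type u) [MulAction CircleZtwo Z]

/-- `Z_ℝ`, the set of fixed points of `τ`. -/
def realPoints : Set Z := {z | tauElt • z = z}

/-- `Z_reg = Z \ 𝕋 Z_ℝ`. -/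
def regPoints : Set Z := {z | ∃ t : Circle, ∃ y ∈ realPoints Z, z = circleElt t • y}ᶜ

end Points

/-- The action is free on `𝕋`: no nontrivial element of `𝕋` fixes a point. -/
def CircleFree (Z : Type u) [MulAction CircleZtwo Z] : Prop :=
  ∀ (t : Circle) (z : Z), circleElt t • z = z → t = 1

/-- The crossed product `C(Z) ⋊ ℤ₂`: its elements are the `f₀ ⊗ 1 + f₁ ⊗ τ` with
`f₀, f₁ ∈ C(Z)`. -/
@[ext]
structure CrossedProduct (Z : Type u) [TopologicalSpace Z] : Type u where
  /-- the coefficient `f₀` of `1` -/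
  f₀ : C(Z, ℂ)
  /-- the coefficient `f₁` of `τ` -/
  f₁ : C(Z, ℂ)

@[simp] lemma tau_smul_smul {Z : Type u} [MulAction CircleZtwo Z] (z : Z) :
    tauElt • tauElt • z = z := by
  rw [smul_smul, tauElt_mul_self, one_smul]

section Action

variable {Z : Type u} [TopologicalSpace Z] [MulAction CircleZtwo Z] [ContinuousSMul CircleZtwo Z]

/-- The automorphism `τ` of `C(Z)`, `(τ f)(z) = f (τ z)` (recall `τ⁻¹ = τ`). -/
def tauFun (f : C(Z, ℂ)) : C(Z, ℂ) := ⟨fun z => f (tauElt • z), by fun_prop⟩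

@[simp] lemma tauFun_apply (f : C(Z, ℂ)) (z : Z) : tauFun f z = f (tauElt • z) := rfl

end Action

namespace CrossedProduct

variable {Z : Type u} [TopologicalSpace Z]

instance : Zero (CrossedProduct Z) := ⟨⟨0, 0⟩⟩
instance : One (CrossedProduct Z) := ⟨⟨1, 0⟩⟩
instance : Add (CrossedProduct Z) := ⟨fun a b => ⟨a.f₀ + b.f₀, a.f₁ + b.f₁⟩⟩
instance : Neg (CrossedProduct Z) := ⟨fun a => ⟨-a.f₀, -a.f₁⟩⟩
instance : Sub (CrossedProduct Z) := ⟨fun a b => ⟨a.f₀ - b.f₀, a.f₁ - b.f₁⟩⟩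
instance {R : Type*} [SMul R C(Z, ℂ)] : SMul R (CrossedProduct Z) :=
  ⟨fun c a => ⟨c • a.f₀, c • a.f₁⟩⟩

@[simp] lemma zero_f₀ : (0 : CrossedProduct Z).f₀ = 0 := rfl
@[simp] lemma zero_f₁ : (0 : CrossedProduct Z).f₁ = 0 := rfl
@[simp] lemma one_f₀ : (1 : CrossedProduct Z).f₀ = 1 := rfl
@[simp] lemma one_f₁ : (1 : CrossedProduct Z).f₁ = 0 := rfl
@[simp] lemma add_f₀ (a b : CrossedProduct Z) : (a + b).f₀ = a.f₀ + b.f₀ := rfl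
@[simp] lemma add_f₁ (a b : CrossedProduct Z) : (a + b).f₁ = a.f₁ + b.f₁ := rfl
@[simp] lemma smul_f₀ {R : Type*} [SMul R C(Z, ℂ)] (c : R) (a : CrossedProduct Z) :
    (c • a).f₀ = c • a.f₀ := rfl
@[simp] lemma smul_f₁ {R : Type*} [SMul R C(Z, ℂ)] (c : R) (a : CrossedProduct Z) :
    (c • a).f₁ = c • a.f₁ := rfl

instance : AddCommGroup (CrossedProduct Z) :=
  Function.Injective.addCommGroup (fun a : CrossedProduct Z => (a.f₀, a.f₁))
    (fun _ _ h => CrossedProduct.ext (congrArg Prod.fst h) (congrArg Prod.snd h))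
    rfl (fun _ _ => rfl) (fun _ => rfl) (fun _ _ => rfl) (fun _ _ => rfl) (fun _ _ => rfl)

instance : Module ℂ (CrossedProduct Z) where
  one_smul a := by ext <;> simp
  mul_smul c d a := by ext <;> simp [mul_assoc]
  smul_zero c := by ext <;> simp
  smul_add c a b := by ext <;> simp [mul_add]
  add_smul c d a := by ext <;> simp [add_mul]
  zero_smul a := by ext <;> simp

variable [MulAction CircleZtwo Z] [ContinuousSMul CircleZtwo Z]

/-- The product determined by `(f ⊗ τ)(g ⊗ 1) = f τ(g) ⊗ τ` and `τ² = 1`. -/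
instance : Mul (CrossedProduct Z) :=
  ⟨fun a b => ⟨a.f₀ * b.f₀ + a.f₁ * tauFun b.f₁, a.f₀ * b.f₁ + a.f₁ * tauFun b.f₀⟩⟩

/-- The involution determined by `(f ⊗ 1)* = f* ⊗ 1` and `(f ⊗ τ)* = τ(f*) ⊗ τ`. -/
instance : Star (CrossedProduct Z) := ⟨fun a => ⟨star a.f₀, tauFun (star a.f₁)⟩⟩

@[simp] lemma mul_f₀ (a b : CrossedProduct Z) :
    (a * b).f₀ = a.f₀ * b.f₀ + a.f₁ * tauFun b.f₁ := rfl
@[simp] lemma mul_f₁ (a b : CrossedProduct Z) :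
    (a * b).f₁ = a.f₀ * b.f₁ + a.f₁ * tauFun b.f₀ := rfl
@[simp] lemma star_f₀ (a : CrossedProduct Z) : (star a).f₀ = star a.f₀ := rfl
@[simp] lemma star_f₁ (a : CrossedProduct Z) : (star a).f₁ = tauFun (star a.f₁) := rfl

instance : Ring (CrossedProduct Z) where
  __ := (inferInstance : AddCommGroup (CrossedProduct Z))
  left_distrib a b c := by ext z <;> simp <;> ring
  right_distrib a b c := by ext z <;> simp <;> ring
  zero_mul a := by ext z <;> simp
  mul_zero a := by ext z <;> simp
  mul_assoc a b c := by ext z <;> simp <;> ring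
  one_mul a := by ext z <;> simp
  mul_one a := by ext z <;> simp

instance : Algebra ℂ (CrossedProduct Z) :=
  Algebra.ofModule (fun c a b => by ext z <;> simp <;> ring)
    (fun c a b => by ext z <;> simp <;> ring)

instance : StarRing (CrossedProduct Z) where
  star_involutive a := by ext z <;> simp
  star_mul a b := by ext z <;> simp <;> ring
  star_add a b := by ext z <;> simp

instance : StarModule ℂ (CrossedProduct Z) where
  star_smul c a := by ext z <;> simp

/-- The two-dimensional representation `θ_z` of the crossed product:
`θ_z (f₀ ⊗ 1 + f₁ ⊗ τ)` has rows `(f₀(z), f₁(z))` and `(f₁(τ z), f₀(τ z))`. -/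
def theta (z : Z) : CrossedProduct Z →⋆ₐ[ℂ] Matrix (Fin 2) (Fin 2) ℂ where
  toFun a :=
    !![a.f₀ z, a.f₁ z; a.f₁ (tauElt • z), a.f₀ (tauElt • z)]
  map_one' := by
    ext i j; fin_cases i <;> fin_cases j <;> simp
  map_mul' a b := by
    ext i j; fin_cases i <;> fin_cases j <;>
      simp [Matrix.mul_apply] <;> ring
  map_zero' := by
    ext i j; fin_cases i <;> fin_cases j <;> simp
  map_add' a b := by
    ext i j; fin_cases i <;> fin_cases j <;> simp
  commutes' c := by
    ext i j; fin_cases i <;> fin_cases j <;>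
      simp [Algebra.algebraMap_eq_smul_one]
  map_star' a := by
    ext i j; fin_cases i <;> fin_cases j <;> simp [Matrix.star_apply]

/-- For `z ∈ Z_ℝ`, the one-dimensional representation `φ_z` of the crossed product:
`φ_z (f₀ ⊗ 1 + f₁ ⊗ τ) = f₀(z) + f₁(z)`. -/
def phi (z : realPoints Z) : CrossedProduct Z →⋆ₐ[ℂ] ℂ where
  toFun a := a.f₀ z + a.f₁ z
  map_one' := by simp
  map_mul' a b := by
    have hz : tauElt • (z : Z) = z := z.2
    simp [hz]; ring
  map_zero' := by simp
  map_add' a b := by simp; ring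
  commutes' c := by simp [Algebra.algebraMap_eq_smul_one]
  map_star' a := by
    have hz : tauElt • (z : Z) = z := z.2
    simp [hz]

open scoped Matrix.Norms.L2Operator

/-- The standard embedding of `C(Z) ⋊ ℤ₂` into `C(Z, M₂(ℂ)) = M₂(C(Z))`. -/
def embedding : CrossedProduct Z →⋆ₐ[ℂ] C(Z, Matrix (Fin 2) (Fin 2) ℂ) where
  toFun a := ⟨fun z => theta z a, by
    refine continuous_matrix fun i j => ?_
    fin_cases i <;> fin_cases j <;> simp [theta] <;> fun_prop⟩
  map_one' := by ext1 z; exact map_one (theta z)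
  map_mul' a b := by ext1 z; exact map_mul (theta z) a b
  map_zero' := by ext1 z; exact map_zero (theta z)
  map_add' a b := by ext1 z; exact map_add (theta z) a b
  commutes' c := by ext1 z; exact AlgHomClass.commutes (theta z) c
  map_star' a := by ext1 z; exact map_star (theta z) a

lemma embedding_injective : Function.Injective (embedding (Z := Z)) := by
  intro a b h
  have h' : ∀ z, theta z a = theta z b := fun z => congrArg (fun g => g z) h
  ext z
  · simpa [theta] using congrFun (congrFun (h' z) 0) 0
  · simpa [theta] using congrFun (congrFun (h' z) 0) 1

lemma range_embedding : Set.range (embedding (Z := Z)) =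
    {g | ∀ z, g (tauElt • z) 0 0 = g z 1 1 ∧ g (tauElt • z) 0 1 = g z 1 0} := by
  ext g
  constructor
  · rintro ⟨a, rfl⟩ z
    simp [embedding, theta]
  · intro h
    refine ⟨⟨⟨fun z => g z 0 0, g.continuous.matrix_elem 0 0⟩,
      ⟨fun z => g z 0 1, g.continuous.matrix_elem 0 1⟩⟩, ?_⟩
    ext z i j
    fin_cases i <;> fin_cases j <;> simp [embedding, theta, h z]

lemma isClosed_range_embedding : IsClosed (Set.range (embedding (Z := Z))) := by
  have hc (z : Z) (i j : Fin 2) :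
      Continuous fun g : C(Z, Matrix (Fin 2) (Fin 2) ℂ) => g z i j :=
    (ContinuousEvalConst.continuous_eval_const z).matrix_elem i j
  rw [range_embedding]
  simp only [Set.ofPred_forall]
  exact isClosed_iInter fun z =>
    (isClosed_eq (hc _ 0 0) (hc _ 1 1)).inter (isClosed_eq (hc _ 0 1) (hc _ 1 0))

variable [CompactSpace Z]

/-- The C*-norm of the crossed product, `‖a‖ = sup_z ‖θ_z(a)‖`. -/
instance : NormedRing (CrossedProduct Z) :=
  NormedRing.induced (CrossedProduct Z) C(Z, Matrix (Fin 2) (Fin 2) ℂ) embedding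
    embedding_injective

lemma norm_def (a : CrossedProduct Z) : ‖a‖ = ‖embedding a‖ := rfl

instance : NormedAlgebra ℂ (CrossedProduct Z) :=
  NormedAlgebra.induced ℂ (CrossedProduct Z) C(Z, Matrix (Fin 2) (Fin 2) ℂ) embedding

lemma isometry_embedding : Isometry (embedding (Z := Z)) :=
  AddMonoidHomClass.isometry_of_norm _ fun _ => rfl

instance : CompleteSpace (CrossedProduct Z) :=
  (completeSpace_iff_isComplete_range isometry_embedding.isUniformInducing).2
    isClosed_range_embedding.isComplete

instance : CStarRing (CrossedProduct Z) where
  norm_mul_self_le a := by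
    simp only [norm_def, map_mul, map_star]
    exact CStarRing.norm_mul_self_le _

/-- The crossed product `C(Z) ⋊ ℤ₂` as a C*-algebra. -/
instance : CStarAlgebra (CrossedProduct Z) where

end CrossedProduct

open CrossedProduct

section HalfReal

open scoped Matrix.Norms.L2Operator

variable (Z : Type u) [TopologicalSpace Z] [MulAction CircleZtwo Z] [ContinuousSMul CircleZtwo Z]

lemma tau_smul_circle_smul {Z : Type u} [MulAction CircleZtwo Z] (t : Circle) (z : Z) :
    tauElt • circleElt t • z = circleElt t⁻¹ • tauElt • z := by
  rw [smul_smul, circleElt_conj, ← smul_smul]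

/-- `C(Z_{ℝ,*}) = {f₀ ⊗ 1 + f₁ ⊗ τ | f₀ ∈ C(Z)^𝕋, f₁ ∈ C_𝕋(Z)} ⊆ C(Z) ⋊ ℤ₂`, where `f₀ ∈ C(Z)^𝕋`
means `f₀ (t z) = f₀ z` and `f₁ ∈ C_𝕋(Z)` means `f₁ (t z) = t f₁ z` for `t ∈ 𝕋`. -/
def halfReal : StarSubalgebra ℂ (CrossedProduct Z) where
  carrier := {a | (∀ (t : Circle) (z : Z), a.f₀ (circleElt t • z) = a.f₀ z) ∧
    ∀ (t : Circle) (z : Z), a.f₁ (circleElt t • z) = (t : ℂ) * a.f₁ z}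
  mul_mem' := by
    rintro a b ⟨ha, ha'⟩ ⟨hb, hb'⟩
    refine ⟨fun t z => ?_, fun t z => ?_⟩
    · have ht : (t : ℂ) * ((t⁻¹ : Circle) : ℂ) = 1 := by
        rw [← Circle.coe_mul]; simp
      simp only [mul_f₀, ContinuousMap.add_apply, ContinuousMap.mul_apply, tauFun_apply,
        tau_smul_circle_smul, ha, hb, ha', hb']
      linear_combination (a.f₁ z * b.f₁ (tauElt • z)) * ht
    · simp only [mul_f₁, ContinuousMap.add_apply, ContinuousMap.mul_apply, tauFun_apply,
        tau_smul_circle_smul, ha, hb, ha', hb']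
      ring
  add_mem' := by
    rintro a b ⟨ha, ha'⟩ ⟨hb, hb'⟩
    exact ⟨fun t z => by simp [ha, hb], fun t z => by simp [ha', hb', mul_add]⟩
  algebraMap_mem' c := by
    refine ⟨fun t z => ?_, fun t z => ?_⟩ <;> simp [Algebra.algebraMap_eq_smul_one]
  star_mem' := by
    rintro a ⟨ha, ha'⟩
    refine ⟨fun t z => by simp [ha], fun t z => ?_⟩
    have ht : (starRingEnd ℂ) ((t⁻¹ : Circle) : ℂ) = t := by
      rw [← Circle.coe_inv_eq_conj, inv_inv]
    simp only [star_f₁, tauFun_apply, ContinuousMap.star_apply, tau_smul_circle_smul, ha', star_mul',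
      RCLike.star_def, ht]

variable [CompactSpace Z]

instance isClosed_halfReal : IsClosed (halfReal Z : Set (CrossedProduct Z)) := by
  have hc (i j : Fin 2) (z : Z) : Continuous fun a : CrossedProduct Z => theta z a i j :=
    ((ContinuousEvalConst.continuous_eval_const
      (F := C(Z, Matrix (Fin 2) (Fin 2) ℂ)) z).comp
      (isometry_embedding (Z := Z)).continuous).matrix_elem i j
  have h0 (z : Z) : Continuous fun a : CrossedProduct Z => a.f₀ z := hc 0 0 z
  have h1 (z : Z) : Continuous fun a : CrossedProduct Z => a.f₁ z := hc 0 1 z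
  have : (halfReal Z : Set (CrossedProduct Z)) =
      {a | (∀ (t : Circle) (z : Z), a.f₀ (circleElt t • z) = a.f₀ z) ∧
        ∀ (t : Circle) (z : Z), a.f₁ (circleElt t • z) = (t : ℂ) * a.f₁ z} := rfl
  rw [this]
  simp only [Set.ofPred_and, Set.ofPred_forall]
  exact (isClosed_iInter fun t => isClosed_iInter fun z => isClosed_eq (h0 _) (h0 _)).inter
    (isClosed_iInter fun t => isClosed_iInter fun z =>
      isClosed_eq (h1 _) ((continuous_const : Continuous fun _ => (t : ℂ)).mul (h1 _)))

/-- The C*-algebra structure of `C(Z_{ℝ,*})`, as a closed *-subalgebra of `C(Z) ⋊ ℤ₂`. -/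
instance : CStarAlgebra (halfReal Z) := StarSubalgebra.cstarAlgebra (halfReal Z)

end HalfReal

/-- A quotient of a unital C*-algebra `A`: a surjective unital *-homomorphism `A → B` onto a unital
C*-algebra (possibly zero). -/
structure CStarQuotient (A : Type u) [CStarAlgebra A] : Type (u + 1) where
  /-- the target C*-algebra -/
  B : Type u
  /-- its C*-algebra structure -/
  [inst : CStarAlgebra B]
  /-- the quotient map -/
  q : A →⋆ₐ[ℂ] B
  surj : Function.Surjective q

attribute [instance] CStarQuotient.inst

/-- Two quotients of `A` are identified when their targets are *-isomorphic compatibly with the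
quotient maps. -/
instance cstarQuotientSetoid (A : Type u) [CStarAlgebra A] : Setoid (CStarQuotient A) where
  r Q Q' := ∃ e : Q.B ≃⋆ₐ[ℂ] Q'.B, ∀ a, e (Q.q a) = Q'.q a
  iseqv := {
    refl := fun Q => ⟨StarAlgEquiv.refl _ _, fun _ => rfl⟩
    symm := by
      rintro Q Q' ⟨e, he⟩
      exact ⟨e.symm, fun a => by rw [← he a]; simp⟩
    trans := by
      rintro Q Q' Q'' ⟨e, he⟩ ⟨e', he'⟩
      exact ⟨e.trans e', fun a => by simp [he, he']⟩ }

/-- The set of quantum subspaces of the quantum space `X` with `C(X) = A`. -/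
def QuantumSubspace (A : Type u) [CStarAlgebra A] : Type (u + 1) :=
  Quotient (cstarQuotientSetoid A)

/-- The quantum subspace given by a quotient of `A`. -/
def CStarQuotient.toSubspace {A : Type u} [CStarAlgebra A] (Q : CStarQuotient A) :
    QuantumSubspace A :=
  Quotient.mk (cstarQuotientSetoid A) Q

/-- A quotient is classical when its C*-algebra is commutative. -/
def CStarQuotient.Classical {A : Type u} [CStarAlgebra A] (Q : CStarQuotient A) : Prop :=
  ∀ x y : Q.B, x * y = y * x

/-- A quantum subspace is classical when its C*-algebra is commutative. -/
def QuantumSubspace.Classical {A : Type u} [CStarAlgebra A] (X : QuantumSubspace A) : Prop :=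
  Quotient.lift CStarQuotient.Classical (by
    have key : ∀ Q Q' : CStarQuotient A, (cstarQuotientSetoid A).r Q Q' → Q.Classical → Q'.Classical := by
      rintro Q Q' ⟨e, -⟩ h x y
      apply e.symm.injective
      rw [map_mul, map_mul, h]
    exact fun Q Q' h => propext ⟨key Q Q' h, key Q' Q ((cstarQuotientSetoid A).symm h)⟩) X

/-- The pairs `(E, F)`, where `E ⊆ Z_reg` is `𝕋 ⋊ ℤ₂`-stable and closed in `Z_reg`, and
`F ⊆ Z_ℝ` is closed with `closure E ∩ Z_ℝ ⊆ F`. -/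
@[ext]
structure SubspacePair (Z : Type u) [TopologicalSpace Z] [MulAction CircleZtwo Z] : Type u where
  /-- the regular part -/
  E : Set Z
  /-- the real part -/
  F : Set Z
  E_subset : E ⊆ regPoints Z
  E_stable : ∀ (g : CircleZtwo), ∀ z ∈ E, g • z ∈ E
  E_closed : E = closure E ∩ regPoints Z
  F_subset : F ⊆ realPoints Z
  F_closed : IsClosed F
  closure_subset : closure E ∩ realPoints Z ⊆ F

end

/-! A quantum subspace is the same as a closed ideal, the kernel of `q`, so the claim is that this
kernel is determined by the irreducible representations that kill it and that every admissible pair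
occurs.

Injectivity (`CStarQuotient.map_eq_zero_iff`). Invariant functions are central in C(Z_ℝ,*), and
‖θ_z(a)‖ is constant along orbits. A partition of unity made of invariant functions therefore shows
that a lies in the kernel as soon as, at each z, some kernel element has the same value θ_z
(`CStarQuotient.eq_zero_of_fibers`). It remains to know θ_z(Ker q). At a regular point θ_z is onto
the simple algebra M₂(ℂ), so the image is 0 or everything. At a real point θ_z splits into the two
characters φ_z and φ_{-z}, which can be prescribed independently, and each of them either vanishes
on the kernel or is free. Every other point lies on the orbit of a real one.

Surjectivity. A pair (E, F) gives the restriction to closure E and F, whose range is a C*-algebra.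
Its kernel must yield no further points. Off E an invariant Urysohn function shows this. Off F the
obstacle is that F may contain -z but not z. There an element is built with φ_z-value 1 but
restriction of norm at most 1/2, and a lift of no larger norm (`StarAlgHom.exists_norm_le_preimage`)
gives a contradiction. -/

/-! ### Norm-controlled lifts and closed ranges of *-homomorphisms. -/

section CStarRange

variable {A B : Type*} [CStarAlgebra A] [CStarAlgebra B]

/-- Every element in the range of a `*`-homomorphism of C*-algebras has a preimage of no larger
norm, obtained by truncating a given preimage with the continuous functional calculus. -/
theorem StarAlgHom.exists_norm_le_preimage (π : A →⋆ₐ[ℂ] B) (a : A) :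
    ∃ a', π a' = π a ∧ ‖a'‖ ≤ ‖π a‖ := by
  rcases (norm_nonneg (π a)).eq_or_lt with h0 | hC
  · exact ⟨0, by rw [map_zero, norm_eq_zero.1 h0.symm], by simp [← h0]⟩
  set C := ‖π a‖ with hCdef
  have hB : Nontrivial B := ⟨π a, 0, fun h => by simp [hCdef, h] at hC⟩
  -- `h` equals 1 on [0, C²], which contains the spectrum of `π (star a * a)`, while t·h(t)² ≤ C²
  -- for all t ≥ 0. So `a * h(star a * a)` has the same image as `a` and norm at most `C`.
  let h : ℝ → ℝ := fun t => C / max C (√t)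
  have hmax (t : ℝ) : 0 < max C (√t) := lt_max_of_lt_left hC
  have hh : Continuous h :=
    continuous_const.div (by fun_prop) fun t => (hmax t).ne'
  let s := star a * a
  have hs : IsSelfAdjoint s := IsSelfAdjoint.star_mul_self a
  have hπs : IsSelfAdjoint (π s) := hs.map π
  have hns : ‖π s‖ = C * C := by
    rw [map_mul, map_star, CStarRing.norm_star_mul_self]
  have hπ : Continuous π := AddMonoidHomClass.continuous_of_bound π 1 fun x => by
    simpa using NonUnitalStarAlgHom.norm_apply_le π x
  have hone : cfc h (π s) = 1 := by
    rw [← cfc_one ℝ (π s) hπs]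
    refine cfc_congr fun t ht => ?_
    have ht' : t ≤ C * C := (le_abs_self t).trans (hns ▸ spectrum.norm_le_norm_of_mem ht)
    have hst : √t ≤ C := Real.sqrt_le_iff.2 ⟨hC.le, by rwa [sq]⟩
    simp only [h, max_eq_left hst, Pi.one_apply]
    exact div_self hC.ne'
  refine ⟨a * cfc h s, ?_, ?_⟩
  · rw [map_mul, StarAlgHom.map_cfc π h s hh.continuousOn hπ hs hπs, hone, mul_one]
  · have hsq : ‖a * cfc h s‖ * ‖a * cfc h s‖ ≤ C * C := by
      have e1 : star (a * cfc h s) * (a * cfc h s) = cfc (fun t => h t * t * h t) s := by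
        rw [star_mul, (cfc_predicate h s : IsSelfAdjoint (cfc h s)).star_eq,
          cfc_mul (fun t => h t * t) h s (by fun_prop) (by fun_prop),
          cfc_mul h (fun t => t) s (by fun_prop) (by fun_prop), cfc_id' ℝ s hs]
        simp only [s, mul_assoc]
      rw [← CStarRing.norm_star_mul_self, e1]
      refine norm_cfc_le (by positivity) fun t ht => ?_
      have ht0 : 0 ≤ t := spectrum_star_mul_self_nonneg t ht
      have e2 : h t * t * h t = C * C * (√t / max C (√t)) ^ 2 := by
        rw [div_pow, Real.sq_sqrt ht0]
        simp only [h]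
        ring
      have h1 : √t / max C (√t) ≤ 1 := (div_le_one (hmax t)).2 (le_max_right _ _)
      have h2 : 0 ≤ √t / max C (√t) := div_nonneg (Real.sqrt_nonneg t) (hmax t).le
      rw [e2, Real.norm_of_nonneg (by positivity)]
      exact mul_le_of_le_one_right (by positivity) (pow_le_one₀ h2 h1)
    exact le_of_not_gt fun hlt => by nlinarith [norm_nonneg (a * cfc h s)]

/-- The range of a `*`-homomorphism of C*-algebras is closed. -/
theorem StarAlgHom.isClosed_range (π : A →⋆ₐ[ℂ] B) : IsClosed (π.range : Set B) := by
  let f : NormedAddGroupHom A B :=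
    (π : A →+ B).mkNormedAddGroupHom 1 fun a => by
      simpa using NonUnitalStarAlgHom.norm_apply_le π a
  have hf : f.SurjectiveOnWith (π : A →+ B).range 1 := by
    rintro _ ⟨a, rfl⟩
    obtain ⟨a', h1, h2⟩ := π.exists_norm_le_preimage a
    exact ⟨a', h1, by simpa using h2⟩
  have hcl := controlled_closure_of_complete one_pos one_pos hf
  refine isClosed_of_closure_subset fun b hb => ?_
  obtain ⟨a, ha, -⟩ := hcl b hb
  exact ⟨a, ha⟩

end CStarRange

/-! ### Quantum subspaces and kernels. -/

section Quotients

/-- Quotients of a C*-algebra with the same kernel define the same quantum subspace. -/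
theorem CStarQuotient.toSubspace_eq {A : Type u} [CStarAlgebra A] {Q Q' : CStarQuotient A}
    (h : ∀ a, Q.q a = 0 ↔ Q'.q a = 0) : Q.toSubspace = Q'.toSubspace := by
  have key (a b : A) : Q.q a = Q.q b ↔ Q'.q a = Q'.q b := by
    rw [← sub_eq_zero, ← map_sub, h, map_sub, sub_eq_zero]
  choose s hs using Q.surj
  have hsa (a : A) : Q'.q (s (Q.q a)) = Q'.q a := (key _ _).1 (hs _)
  -- The section `s` need not respect any structure: by `key` the value `Q'.q (s b)` does not depend
  -- on the chosen lift.
  let f : Q.B →⋆ₐ[ℂ] Q'.B :=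
    { toFun := fun b => Q'.q (s b)
      map_one' := by rw [← map_one Q.q, hsa, map_one]
      map_mul' := fun x y => by rw [← map_mul, ← key, map_mul, hs, hs, hs]
      map_zero' := by rw [← map_zero Q.q, hsa, map_zero]
      map_add' := fun x y => by rw [← map_add, ← key, map_add, hs, hs, hs]
      commutes' := fun c => by
        rw [← AlgHomClass.commutes Q.q c, hsa, AlgHomClass.commutes]
      map_star' := fun x => by rw [← map_star, ← key, map_star, hs, hs] }
  have hf : Function.Bijective f := by
    constructor
    · intro x y hxy
      rw [← hs x, ← hs y]
      exact (key _ _).2 hxy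
    · intro y
      obtain ⟨a, rfl⟩ := Q'.surj y
      exact ⟨Q.q a, hsa a⟩
  exact Quotient.sound ⟨StarAlgEquiv.ofBijective f hf, hsa⟩

/-- Kernels of quotients defining the same quantum subspace agree. -/
theorem CStarQuotient.map_eq_zero_iff_of_equiv {A : Type u} [CStarAlgebra A]
    {Q Q' : CStarQuotient A} (h : (cstarQuotientSetoid A).r Q Q') (a : A) :
    Q.q a = 0 ↔ Q'.q a = 0 := by
  obtain ⟨e, he⟩ := h
  rw [← he, map_eq_zero_iff e e.injective]

/-- The quotient of a C*-algebra given by a `*`-homomorphism onto its range. -/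
noncomputable def CStarQuotient.ofHom {A B : Type u} [CStarAlgebra A] [CStarAlgebra B]
    (π : A →⋆ₐ[ℂ] B) : CStarQuotient A :=
  letI : IsClosed (π.range : Set B) := π.isClosed_range
  { B := π.range
    inst := StarSubalgebra.cstarAlgebra π.range
    q := π.rangeRestrict
    surj := by
      rintro ⟨_, a, rfl⟩
      exact ⟨a, rfl⟩ }

theorem CStarQuotient.ofHom_eq_zero_iff {A B : Type u} [CStarAlgebra A] [CStarAlgebra B]
    (π : A →⋆ₐ[ℂ] B) (a : A) : (CStarQuotient.ofHom π).q a = 0 ↔ π a = 0 :=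
  Subtype.ext_iff

end Quotients

open CrossedProduct MeasureTheory

/-! ### Haar measure on the circle and the elements of 𝕋 ⋊ ℤ₂. -/

section CircleGroup

noncomputable instance Circle.instMeasurableSpace : MeasurableSpace Circle := borel Circle

instance Circle.instBorelSpace : BorelSpace Circle := ⟨rfl⟩

/-- The normalized Haar measure of the circle group. -/
noncomputable def circleHaar : Measure Circle := Measure.haarMeasure ⊤

instance : IsProbabilityMeasure circleHaar := ⟨Measure.haarMeasure_self⟩

instance : circleHaar.IsHaarMeasure := inferInstanceAs (Measure.haarMeasure _).IsHaarMeasure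

theorem CircleZtwo.eq_circleElt_or (g : CircleZtwo) :
    g = circleElt g.left ∨ g = circleElt g.left * tauElt := by
  have h : ∀ s : Ztwo, s = 1 ∨ s = Multiplicative.ofAdd 1 := by decide
  rcases h g.right with h | h
  · exact Or.inl (SemidirectProduct.ext (by simp [circleElt]) (by simp [circleElt, h]))
  · exact Or.inr (SemidirectProduct.ext (by simp [circleElt, tauElt])
      (by simp [circleElt, tauElt, h]))

theorem circleElt_mul (s t : Circle) : circleElt (s * t) = circleElt s * circleElt t :=
  map_mul _ s t

theorem circleElt_one : circleElt 1 = 1 := map_one _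

theorem continuous_circleElt : Continuous circleElt := by
  refine continuous_induced_rng.2 ?_
  change Continuous fun t : Circle => ((circleElt t).left, (circleElt t).right)
  simp only [circleElt, SemidirectProduct.left_inl, SemidirectProduct.right_inl]
  fun_prop

/-- A condition that passes from `z` to `t z` and `τ z` holds along the whole orbit. -/
theorem CircleZtwo.smul_induction {Z : Type u} [MulAction CircleZtwo Z] {p : Z → Prop}
    (hc : ∀ (t : Circle) z, p z → p (circleElt t • z)) (hτ : ∀ z, p z → p (tauElt • z))
    (g : CircleZtwo) {z : Z} (hz : p z) : p (g • z) := by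
  rcases g.eq_circleElt_or with h | h
  · rw [h]
    exact hc _ _ hz
  · rw [h, mul_smul]
    exact hc _ _ (hτ _ hz)

end CircleGroup

/-! ### Averaging: invariant and equivariant functions. -/

section Averages

variable {Z : Type u} [TopologicalSpace Z] [MulAction CircleZtwo Z] [ContinuousSMul CircleZtwo Z]

@[fun_prop]
theorem Continuous.circleElt_smul {X : Type*} [TopologicalSpace X] {t : X → Circle} {z : X → Z}
    (ht : Continuous t) (hz : Continuous z) : Continuous fun x => circleElt (t x) • z x :=
  (continuous_circleElt.comp ht).smul hz

theorem isClosed_realPoints [T2Space Z] : IsClosed (realPoints Z) :=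
  isClosed_eq (by fun_prop) continuous_id

theorem isCompact_circleSaturation {S : Set Z} (hS : IsCompact S) :
    IsCompact {z | ∃ t : Circle, ∃ y ∈ S, z = circleElt t • y} := by
  have h := (isCompact_univ (X := Circle)).prod hS |>.image
    (f := fun p : Circle × Z => circleElt p.1 • p.2) (by fun_prop)
  convert h using 1
  ext z
  simp [eq_comm]

theorem isCompact_saturation {S : Set Z} (hS : IsCompact S) :
    IsCompact {z | ∃ g : CircleZtwo, ∃ y ∈ S, z = g • y} := by
  have hτ := hS.image (f := fun z : Z => tauElt • z) (by fun_prop)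
  convert (isCompact_circleSaturation hS).union (isCompact_circleSaturation hτ) using 1
  ext z
  constructor
  · rintro ⟨g, y, hy, rfl⟩
    rcases g.eq_circleElt_or with h | h
    · exact Or.inl ⟨_, y, hy, by rw [← h]⟩
    · exact Or.inr ⟨_, _, ⟨y, hy, rfl⟩, by rw [smul_smul, ← h]⟩
  · rintro (⟨t, y, hy, rfl⟩ | ⟨t, _, ⟨y, hy, rfl⟩, rfl⟩)
    · exact ⟨_, y, hy, rfl⟩
    · exact ⟨_, y, hy, smul_smul _ _ _⟩

variable [CompactSpace Z] {𝕜 : Type*} [RCLike 𝕜]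

/-- The map `t ↦ c(t) f(t ·)` from the circle to `C(Z)`. -/
noncomputable def circleOrbitMap (c : C(Circle, 𝕜)) (f : C(Z, 𝕜)) : C(Circle, C(Z, 𝕜)) :=
  ContinuousMap.curry ⟨fun p => c p.1 * f (circleElt p.1 • p.2), by fun_prop⟩

/-- The weighted average `z ↦ ∫ c(t) f(t z) dt` over the circle. -/
noncomputable def circleAverage (c : C(Circle, 𝕜)) (f : C(Z, 𝕜)) : C(Z, 𝕜) :=
  ∫ t, circleOrbitMap c f t ∂circleHaar

theorem integrable_circleHaar {F : Type*} [NormedAddCommGroup F] {f : Circle → F}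
    (hf : Continuous f) : Integrable f circleHaar :=
  hf.integrable_of_hasCompactSupport (HasCompactSupport.of_compactSpace f)

theorem circleAverage_apply (c : C(Circle, 𝕜)) (f : C(Z, 𝕜)) (z : Z) :
    circleAverage c f z = ∫ t, c t * f (circleElt t • z) ∂circleHaar :=
  ContinuousMap.integral_apply (integrable_circleHaar (circleOrbitMap c f).continuous) z

theorem circleAverage_circleElt_smul (c : C(Circle, 𝕜)) (f : C(Z, 𝕜)) (s : Circle) (z : Z) :
    circleAverage c f (circleElt s • z) =
      ∫ t, c (t * s⁻¹) * f (circleElt t • z) ∂circleHaar := by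
  rw [circleAverage_apply, 
    ← integral_mul_right_eq_self (fun t => c (t * s⁻¹) * f (circleElt t • z)) s]
  simp [circleElt_mul, mul_smul]

/-- The average of a real function over the orbits of `𝕋 ⋊ ℤ₂`. -/
noncomputable def orbitAverage (f : C(Z, ℝ)) : C(Z, ℝ) :=
  (1 / 2 : ℝ) • (circleAverage 1 f + circleAverage 1 (f.comp ⟨fun z => tauElt • z, by fun_prop⟩))

theorem orbitAverage_apply (f : C(Z, ℝ)) (z : Z) :
    orbitAverage f z = 1 / 2 * (∫ t, f (circleElt t • z) ∂circleHaar +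
      ∫ t, f (tauElt • circleElt t • z) ∂circleHaar) := by
  simp [orbitAverage, circleAverage_apply, mul_add]

/-- Translation invariance of Haar measure handles 𝕋. Replacing z by τz exchanges the two integrals
after the substitution t ↦ t⁻¹. -/
theorem orbitAverage_smul (f : C(Z, ℝ)) (g : CircleZtwo) (z : Z) :
    orbitAverage f (g • z) = orbitAverage f z := by
  refine CircleZtwo.smul_induction (p := fun y => orbitAverage f y = orbitAverage f z)
    (fun s y hy => ?_) (fun y hy => ?_) g rfl
  · rw [← hy]
    simp only [orbitAverage, ContinuousMap.smul_apply, ContinuousMap.add_apply,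
      circleAverage_circleElt_smul]
    simp [circleAverage_apply]
  · have h (t : Circle) : circleElt t • tauElt • y = tauElt • circleElt t⁻¹ • y := by
      rw [tau_smul_circle_smul, inv_inv]
    rw [← hy, orbitAverage_apply, orbitAverage_apply, add_comm]
    simp only [h, tau_smul_smul]
    rw [integral_inv_eq_self (fun t => f (circleElt t • y)) circleHaar,
      integral_inv_eq_self (fun t => f (tauElt • circleElt t • y)) circleHaar]

theorem orbitAverage_nonneg {f : C(Z, ℝ)} (hf : ∀ z, 0 ≤ f z) (z : Z) : 0 ≤ orbitAverage f z := by
  rw [orbitAverage_apply]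
  have h1 := integral_nonneg (μ := circleHaar) (f := fun t => f (circleElt t • z)) fun t =>
    hf (circleElt t • z)
  have h2 := integral_nonneg (μ := circleHaar) (f := fun t => f (tauElt • circleElt t • z)) fun t =>
    hf (tauElt • circleElt t • z)
  positivity

theorem orbitAverage_eq_of_orbit {f : C(Z, ℝ)} {c : ℝ} {z : Z}
    (hf : ∀ g : CircleZtwo, f (g • z) = c) : orbitAverage f z = c := by
  rw [orbitAverage_apply]
  simp only [smul_smul, hf]
  simp
  ring

theorem orbitAverage_sum {ι : Type*} (s : Finset ι) (f : ι → C(Z, ℝ)) (z : Z) :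
    orbitAverage (∑ i ∈ s, f i) z = ∑ i ∈ s, orbitAverage (f i) z := by
  have h (i : ι) : Continuous fun t : Circle => f i (circleElt t • z) := by fun_prop
  have h' (i : ι) : Continuous fun t : Circle => f i (tauElt • circleElt t • z) := by fun_prop
  simp only [orbitAverage_apply, ContinuousMap.sum_apply]
  rw [integral_finsetSum s fun i _ => integrable_circleHaar (h i),
    integral_finsetSum s fun i _ => integrable_circleHaar (h' i), ← Finset.sum_add_distrib,
    Finset.mul_sum]

variable [T2Space Z]

/-- An invariant Urysohn function separating a closed stable set from an orbit. -/
theorem exists_invariant_zero_one {C : Set Z} (hC : IsClosed C)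
    (hCs : ∀ g : CircleZtwo, ∀ z ∈ C, g • z ∈ C) {z : Z} (hz : z ∉ C) :
    ∃ h : C(Z, ℝ), (∀ (g : CircleZtwo) y, h (g • y) = h y) ∧ (∀ y ∈ C, h y = 0) ∧ h z = 1 ∧
      ∀ y, h y ∈ Set.Icc (0 : ℝ) 1 := by
  have hO := (isCompact_saturation (isCompact_singleton (x := z))).isClosed
  obtain ⟨f, f0, f1, f01⟩ := exists_continuous_zero_one_of_isClosed hC hO (by
    rw [Set.disjoint_right]
    rintro _ ⟨g, y, rfl, rfl⟩ hy
    exact hz (by simpa using hCs g⁻¹ _ hy))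
  -- Both closed sets are stable, so averaging keeps the values 0 and 1 there. The upper bound comes
  -- from averaging `1 - f`.
  refine ⟨orbitAverage f, orbitAverage_smul f,
    fun y hy => orbitAverage_eq_of_orbit fun g => f0 (hCs g y hy),
    orbitAverage_eq_of_orbit fun g => f1 ⟨g, z, rfl, rfl⟩,
    fun y => ⟨orbitAverage_nonneg (fun x => (f01 x).1) y, ?_⟩⟩
  have h := orbitAverage_nonneg (f := 1 - f) (fun x => by simpa using (f01 x).2) y
  have hs := orbitAverage_sum Finset.univ ![f, 1 - f] y
  have h1 : orbitAverage (1 : C(Z, ℝ)) y = 1 := orbitAverage_eq_of_orbit fun _ => rfl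
  simp only [Fin.sum_univ_two, Matrix.cons_val_zero, Matrix.cons_val_one,
    add_sub_cancel, h1] at hs
  linarith

/-- A function with `f (t y) = t f y` for `t ∈ 𝕋` that takes the value `1` at a given point and
vanishes on a closed `𝕋`-stable set not containing that point. -/
theorem exists_equivariant_eq_one (hfree : CircleFree Z) {C : Set Z} (hC : IsClosed C)
    (hCs : ∀ t : Circle, ∀ z ∈ C, circleElt t • z ∈ C) {z : Z} (hz : z ∉ C) :
    ∃ f : C(Z, ℂ), (∀ (t : Circle) y, f (circleElt t • y) = t * f y) ∧ f z = 1 ∧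
      ∀ y ∈ C, f y = 0 := by
  have hinj : Function.Injective fun t : Circle => circleElt t • z := by
    intro s t hst
    refine eq_of_inv_mul_eq_one (hfree _ z ?_) |>.symm
    change circleElt s • z = circleElt t • z at hst
    rw [circleElt_mul, mul_smul, hst, smul_smul, ← circleElt_mul, inv_mul_cancel, circleElt_one,
      one_smul]
  have he : Topology.IsClosedEmbedding fun t : Circle => circleElt t • z :=
    Continuous.isClosedEmbedding (by fun_prop) hinj
  -- By freeness the orbit of `z` is a copy of 𝕋, so t z ↦ t is well defined on it and extends by
  -- Tietze. The cutoff `u` then kills `C`, and averaging against t⁻¹ restores equivariance.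
  obtain ⟨g, hg⟩ := ContinuousMap.exists_extension he ⟨fun t : Circle => (t : ℂ), by fun_prop⟩
  have hg' (t : Circle) : g (circleElt t • z) = t := congrArg (fun f => f t) hg
  obtain ⟨u, u0, u1, -⟩ := exists_continuous_zero_one_of_isClosed hC
    he.isClosed_range (by
      rw [Set.disjoint_right]
      rintro _ ⟨t, rfl⟩ hy
      refine hz ?_
      have h := hCs t⁻¹ _ hy
      rwa [smul_smul, ← circleElt_mul, inv_mul_cancel, circleElt_one, one_smul] at h)
  have u0' (t : Circle) (y : Z) (hy : y ∈ C) : u (circleElt t • y) = 0 := u0 (hCs t y hy)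
  have u1' (t : Circle) : u (circleElt t • z) = 1 := u1 ⟨t, rfl⟩
  let c : C(Circle, ℂ) := ⟨fun t => ((t⁻¹ : Circle) : ℂ), by fun_prop⟩
  refine ⟨circleAverage c ⟨fun y => g y * (u y : ℂ), by fun_prop⟩, fun t y => ?_, ?_,
    fun y hy => ?_⟩
  · rw [circleAverage_circleElt_smul, circleAverage_apply, ← integral_const_mul]
    congr 1
    ext s
    simp [c]
    ring
  · rw [circleAverage_apply]
    simp [hg', u1', c]
  · rw [circleAverage_apply]
    simp [u0' _ y hy]

end Averages

/-! ### Real and regular orbits. -/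

section Orbits

variable {Z : Type u} [MulAction CircleZtwo Z]

/-- Used for t = -1: real points come in pairs z, -z. -/
theorem circleElt_smul_mem_realPoints_iff {t : Circle} (ht : t⁻¹ = t) {z : Z} :
    circleElt t • z ∈ realPoints Z ↔ z ∈ realPoints Z := by
  simp only [realPoints, Set.mem_ofPred_eq, tau_smul_circle_smul, ht, smul_left_cancel_iff]

/-- If τz = s²z, then τ(sz) = s⁻¹τz = sz, so z is a rotate of a real point. Thus a regular orbit
consists of two distinct circles. -/
theorem tau_smul_ne_of_mem_regPoints {z : Z} (hz : z ∈ regPoints Z) (t : Circle) :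
    tauElt • z ≠ circleElt t • z := by
  intro h
  obtain ⟨s, rfl⟩ : ∃ s : Circle, t = s * s :=
    ⟨Circle.exp (Complex.arg t / 2), by rw [← Circle.exp_add, add_halves, Circle.exp_arg]⟩
  refine hz ⟨s⁻¹, circleElt s • z, ?_, ?_⟩
  · change tauElt • circleElt s • z = circleElt s • z
    rw [tau_smul_circle_smul, h, smul_smul, ← circleElt_mul, inv_mul_cancel_left]
  · rw [smul_smul, ← circleElt_mul, inv_mul_cancel, circleElt_one, one_smul]

theorem smul_mem_regPoints (g : CircleZtwo) {z : Z} (hz : z ∈ regPoints Z) :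
    g • z ∈ regPoints Z := by
  refine CircleZtwo.smul_induction (p := (· ∈ regPoints Z)) ?_ ?_ g hz
  · rintro t z hz ⟨s, y, hy, h⟩
    refine hz ⟨t⁻¹ * s, y, hy, ?_⟩
    rw [circleElt_mul, mul_smul, ← h, smul_smul, ← circleElt_mul, inv_mul_cancel, circleElt_one,
      one_smul]
  · rintro z hz ⟨s, y, hy, h⟩
    refine hz ⟨s⁻¹, y, hy, ?_⟩
    have hy' : tauElt • y = y := hy
    rw [← tau_smul_smul z, h, tau_smul_circle_smul, hy']

end Orbits

/-! ### The representations θ_z and φ_z on C(Z_ℝ,*). -/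

section Representations

open scoped Matrix.Norms.L2Operator

variable {Z : Type u} [TopologicalSpace Z] [MulAction CircleZtwo Z] [ContinuousSMul CircleZtwo Z]

theorem theta_apply (z : Z) (a : CrossedProduct Z) :
    theta z a = !![a.f₀ z, a.f₁ z; a.f₁ (tauElt • z), a.f₀ (tauElt • z)] := rfl

theorem phi_apply (z : realPoints Z) (a : CrossedProduct Z) : phi z a = a.f₀ z + a.f₁ z := rfl

theorem halfReal.f₀_smul (a : halfReal Z) (t : Circle) (z : Z) :
    (a : CrossedProduct Z).f₀ (circleElt t • z) = (a : CrossedProduct Z).f₀ z := a.2.1 t z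

theorem halfReal.f₁_smul (a : halfReal Z) (t : Circle) (z : Z) :
    (a : CrossedProduct Z).f₁ (circleElt t • z) = t * (a : CrossedProduct Z).f₁ z := a.2.2 t z

/-- On `C(Z_{ℝ,*})` the representations at points of one orbit are unitarily equivalent. -/
theorem exists_unitary_theta_smul (g : CircleZtwo) (z : Z) :
    ∃ U ∈ unitary (Matrix (Fin 2) (Fin 2) ℂ), ∀ a : halfReal Z,
      theta (g • z) (a : CrossedProduct Z) = U * theta z (a : CrossedProduct Z) * star U := by
  refine CircleZtwo.smul_induction
    (p := fun y => ∃ U ∈ unitary (Matrix (Fin 2) (Fin 2) ℂ), ∀ a : halfReal Z,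
      theta y (a : CrossedProduct Z) = U * theta z (a : CrossedProduct Z) * star U)
    ?_ ?_ g ⟨1, one_mem _, fun a => by simp⟩
  · rintro t y ⟨U, hU, h⟩
    have ht : (t : ℂ) * (starRingEnd ℂ) (t : ℂ) = 1 := by
      rw [← Circle.coe_inv_eq_conj, ← Circle.coe_mul]; simp
    have ht' : (starRingEnd ℂ) (t : ℂ) * t = 1 := by rw [mul_comm, ht]
    -- Passing from y to ty multiplies the entries f₁(y) and f₁(τy) by t and t⁻¹, which is
    -- conjugation by diag(t, 1).
    let V : Matrix (Fin 2) (Fin 2) ℂ := !![(t : ℂ), 0; 0, 1]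
    have hV : V ∈ unitary (Matrix (Fin 2) (Fin 2) ℂ) := by
      constructor <;> ext i j <;> fin_cases i <;> fin_cases j <;>
        simp [V, Matrix.mul_apply, Matrix.star_apply, ht, ht']
    refine ⟨V * U, mul_mem hV hU, fun a => ?_⟩
    have e : theta (circleElt t • y) (a : CrossedProduct Z) =
        V * theta y (a : CrossedProduct Z) * star V := by
      rw [theta_apply, theta_apply, tau_smul_circle_smul]
      simp only [halfReal.f₀_smul, halfReal.f₁_smul]
      ext i j
      fin_cases i <;> fin_cases j <;>
        simp [V, Matrix.mul_apply, Matrix.star_apply, Circle.coe_inv_eq_conj, -Circle.coe_inv]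
      · linear_combination -(a : CrossedProduct Z).f₀ y * ht
      · ring
    rw [e, h, star_mul]
    simp only [mul_assoc]
  · rintro y ⟨U, hU, h⟩
    let V : Matrix (Fin 2) (Fin 2) ℂ := !![0, 1; 1, 0]
    have hV : V ∈ unitary (Matrix (Fin 2) (Fin 2) ℂ) := by
      constructor <;> ext i j <;> fin_cases i <;> fin_cases j <;>
        simp [V, Matrix.mul_apply, Matrix.star_apply]
    refine ⟨V * U, mul_mem hV hU, fun a => ?_⟩
    have e : theta (tauElt • y) (a : CrossedProduct Z) =
        V * theta y (a : CrossedProduct Z) * star V := by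
      rw [theta_apply, theta_apply, tau_smul_smul]
      ext i j
      fin_cases i <;> fin_cases j <;> simp [V, Matrix.mul_apply, Matrix.star_apply]
    rw [e, h, star_mul]
    simp only [mul_assoc]

theorem norm_theta_smul (g : CircleZtwo) (z : Z) (a : halfReal Z) :
    ‖theta (g • z) (a : CrossedProduct Z)‖ = ‖theta z (a : CrossedProduct Z)‖ := by
  obtain ⟨U, hU, h⟩ := exists_unitary_theta_smul g z
  rw [h, CStarRing.norm_mul_mem_unitary _ (Unitary.star_mem hU),
    CStarRing.norm_mem_unitary_mul _ hU]

theorem theta_smul_eq_zero_iff (g : CircleZtwo) (z : Z) (a : halfReal Z) :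
    theta (g • z) (a : CrossedProduct Z) = 0 ↔ theta z (a : CrossedProduct Z) = 0 := by
  rw [← norm_eq_zero, norm_theta_smul, norm_eq_zero]

theorem theta_smul_eq_iff (g : CircleZtwo) (z : Z) (a b : halfReal Z) :
    theta (g • z) (a : CrossedProduct Z) = theta (g • z) (b : CrossedProduct Z) ↔
      theta z (a : CrossedProduct Z) = theta z (b : CrossedProduct Z) := by
  have h := theta_smul_eq_zero_iff g z (a - b)
  rw [AddSubgroupClass.coe_sub] at h
  rwa [map_sub, map_sub, sub_eq_zero, sub_eq_zero] at h

theorem continuous_theta (a : CrossedProduct Z) : Continuous fun z : Z => theta z a :=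
  (embedding a).continuous

/-- The central element of `C(Z_{ℝ,*})` given by an invariant function. -/
noncomputable def halfReal.ofInvariant (h : C(Z, ℝ)) (hh : ∀ (g : CircleZtwo) z, h (g • z) = h z) :
    halfReal Z :=
  ⟨⟨⟨fun z => (h z : ℂ), by fun_prop⟩, 0⟩, fun t z => by simp [hh], fun t z => by simp⟩

theorem theta_ofInvariant (h : C(Z, ℝ)) (hh : ∀ (g : CircleZtwo) z, h (g • z) = h z) (z : Z) :
    theta z (halfReal.ofInvariant h hh : CrossedProduct Z) = (h z : ℂ) • 1 := by
  rw [theta_apply]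
  ext i j
  fin_cases i <;> fin_cases j <;> simp [halfReal.ofInvariant, hh]

theorem theta_ofInvariant_mul (h : C(Z, ℝ)) (hh : ∀ (g : CircleZtwo) z, h (g • z) = h z) (z : Z)
    (a : halfReal Z) : theta z ((halfReal.ofInvariant h hh * a : halfReal Z) : CrossedProduct Z) =
      (h z : ℂ) • theta z (a : CrossedProduct Z) := by
  change theta z (_ * _) = _
  rw [map_mul, theta_ofInvariant, smul_mul_assoc, one_mul]

theorem phi_ofInvariant_mul (h : C(Z, ℝ)) (hh : ∀ (g : CircleZtwo) z, h (g • z) = h z)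
    (z : realPoints Z) (a : halfReal Z) :
    phi z ((halfReal.ofInvariant h hh * a : halfReal Z) : CrossedProduct Z) =
      (h z : ℂ) * phi z (a : CrossedProduct Z) := by
  change phi z (_ * _) = _
  rw [map_mul]
  simp [phi_apply, halfReal.ofInvariant]

theorem phi_eq_zero_of_theta_eq_zero (z : realPoints Z) {a : CrossedProduct Z}
    (h : theta (z : Z) a = 0) : phi z a = 0 := by
  have h0 := congrFun (congrFun h 0) 0
  have h1 := congrFun (congrFun h 0) 1
  simp only [theta_apply, Matrix.of_apply, Matrix.cons_val', Matrix.cons_val_zero,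
    Matrix.cons_val_one, Matrix.cons_val_fin_one, Matrix.zero_apply] at h0 h1
  rw [phi_apply, h0, h1, add_zero]

variable [CompactSpace Z]

theorem norm_le_of_theta_le {a : CrossedProduct Z} {C : ℝ} (hC : 0 ≤ C)
    (h : ∀ z, ‖theta z a‖ ≤ C) : ‖a‖ ≤ C :=
  (ContinuousMap.norm_le (embedding a) hC).2 h

variable [T2Space Z]

/-- The representations at points of `Z_reg` are onto `M₂(ℂ)`. -/
theorem exists_theta_eq (hfree : CircleFree Z) {z : Z} (hz : z ∈ regPoints Z)
    (M : Matrix (Fin 2) (Fin 2) ℂ) : ∃ a : halfReal Z, theta z (a : CrossedProduct Z) = M := by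
  have hC := (isCompact_circleSaturation (isCompact_singleton (x := tauElt • z))).isClosed
  obtain ⟨f, hf, f1, f0⟩ := exists_equivariant_eq_one hfree hC (z := z) (by
      rintro t _ ⟨s, y, hy, rfl⟩
      exact ⟨t * s, y, hy, by rw [circleElt_mul, mul_smul]⟩) (by
      rintro ⟨t, y, rfl, h⟩
      refine tau_smul_ne_of_mem_regPoints hz t⁻¹ ?_
      nth_rw 2 [h]
      rw [smul_smul, ← circleElt_mul, inv_mul_cancel, circleElt_one, one_smul])
  have f0' : f (tauElt • z) = 0 := f0 _ ⟨1, _, rfl, by rw [circleElt_one, one_smul]⟩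
  -- `k` is equivariant as well, because τ inverts t and the conjugation undoes this. At (z, τz) the
  -- pair `f`, `k` takes the values (1, 0) and (0, 1), so the four entries can be chosen separately.
  let k : C(Z, ℂ) := star (tauFun f)
  have hk (t : Circle) (y : Z) : k (circleElt t • y) = t * k y := by
    simp [k, tau_smul_circle_smul, hf, Circle.coe_inv_eq_conj, -Circle.coe_inv]
  have ht (t : Circle) : (t : ℂ) * (starRingEnd ℂ) (t : ℂ) = 1 := by
    rw [← Circle.coe_inv_eq_conj, ← Circle.coe_mul]; simp
  refine ⟨⟨⟨M 0 0 • (f * star f) + M 1 1 • (k * star k), M 0 1 • f + M 1 0 • k⟩,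
    fun t y => ?_, fun t y => ?_⟩, ?_⟩
  · simp [hf, hk]
    linear_combination (M 0 0 * (f y * (starRingEnd ℂ) (f y)) +
      M 1 1 * (k y * (starRingEnd ℂ) (k y))) * ht t
  · simp [hf, hk]
    ring
  · rw [theta_apply]
    ext i j
    fin_cases i <;> fin_cases j <;> simp [k, f1, f0']

/-- At a point of `Z_ℝ` the two characters given by `z` and `-z` can be prescribed. -/
theorem exists_f₀_eq_f₁_eq (hfree : CircleFree Z) (z : Z) (x y : ℂ) :
    ∃ a : halfReal Z, (∀ w, (a : CrossedProduct Z).f₀ w = x) ∧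
      (a : CrossedProduct Z).f₁ z = y := by
  obtain ⟨f, hf, f1, -⟩ := exists_equivariant_eq_one hfree (isClosed_empty (X := Z))
    (fun _ _ h => h.elim) (Set.notMem_empty z)
  refine ⟨⟨⟨.const Z x, y • f⟩, fun t w => rfl, fun t w => ?_⟩, fun w => rfl, ?_⟩
  · simp [hf]
    ring
  · simp [f1]

end Representations

/-! ### From a quotient to its pair. -/

section Fibers

open scoped Matrix.Norms.L2Operator

variable {Z : Type u} [TopologicalSpace Z] [MulAction CircleZtwo Z] [ContinuousSMul CircleZtwo Z]
  [CompactSpace Z]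

/-- The regular part of the pair of a quotient. -/
def CStarQuotient.regPart (Q : CStarQuotient (halfReal Z)) : Set Z :=
  {z | z ∈ regPoints Z ∧
    ∀ a : halfReal Z, Q.q a = 0 → theta z (a : CrossedProduct Z) = 0}

/-- The real part of the pair of a quotient. -/
def CStarQuotient.realPart (Q : CStarQuotient (halfReal Z)) : Set Z :=
  {z | ∃ hz : z ∈ realPoints Z,
    ∀ a : halfReal Z, Q.q a = 0 → phi ⟨z, hz⟩ (a : CrossedProduct Z) = 0}

/-- Vanishing of θ_z on the kernel is a closed condition on z. This gives both closedness of E in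
Z_reg and the inclusion of its real limit points in F. -/
theorem CStarQuotient.closure_regPart_subset (Q : CStarQuotient (halfReal Z)) :
    closure Q.regPart ⊆
      {z | ∀ a : halfReal Z, Q.q a = 0 → theta z (a : CrossedProduct Z) = 0} := by
  refine closure_minimal (fun z hz => hz.2) ?_
  simp only [Set.ofPred_forall]
  exact isClosed_iInter fun a => isClosed_iInter fun _ =>
    isClosed_eq (continuous_theta _) continuous_const

variable [T2Space Z]

/-- An element that agrees with the kernel of a quotient in every fibre lies in the kernel. -/
theorem CStarQuotient.eq_zero_of_fibers (Q : CStarQuotient (halfReal Z)) (a : halfReal Z)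
    (h : ∀ z : Z, ∃ i : halfReal Z, Q.q i = 0 ∧
      theta z (i : CrossedProduct Z) = theta z (a : CrossedProduct Z)) : Q.q a = 0 := by
  choose i hi hia using h
  refine norm_le_zero_iff.1 (le_of_forall_pos_le_add fun ε hε => ?_)
  rw [zero_add]
  let V : Z → Set Z := fun z => {y | ‖theta y ((a - i z : halfReal Z) : CrossedProduct Z)‖ < ε}
  have hV (z : Z) : IsOpen (V z) :=
    isOpen_lt (continuous_theta _).norm continuous_const
  obtain ⟨s, hs⟩ := isCompact_univ.elim_finite_subcover V hV fun z _ => by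
    refine Set.mem_iUnion.2 ⟨z, ?_⟩
    change ‖theta z ((a : CrossedProduct Z) - (i z : CrossedProduct Z))‖ < ε
    rw [map_sub, hia, sub_self, norm_zero]
    exact hε
  let e := s.equivFin
  obtain ⟨f, hfV, hf1, hf01, -⟩ := exists_continuous_sum_one_of_isOpen_isCompact
    (s := fun n => V (e.symm n : Z)) (fun n => hV _) isCompact_univ fun z hz => by
      obtain ⟨w, hw, hz⟩ := Set.mem_iUnion₂.1 (hs hz)
      refine Set.mem_iUnion.2 ⟨e ⟨w, hw⟩, ?_⟩
      simpa using hz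
  -- Averaging makes the coefficients central. The cover survives it because each `V z` is
  -- orbit-stable, θ at points of one orbit being unitarily equivalent.
  let m : Fin s.card → C(Z, ℝ) := fun n => orbitAverage (f n)
  have hm0 (n) (z : Z) : 0 ≤ m n z := orbitAverage_nonneg (fun x => (hf01 n x).1) z
  have hm1 (z : Z) : ∑ n, m n z = 1 := by
    rw [← orbitAverage_sum]
    refine orbitAverage_eq_of_orbit fun g => ?_
    simpa using hf1 (Set.mem_univ (g • z))
  have hmV (n) (z : Z) (hz : z ∉ V (e.symm n : Z)) : m n z = 0 := by
    refine orbitAverage_eq_of_orbit fun g => ?_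
    refine image_eq_zero_of_notMem_tsupport fun hg => hz ?_
    have := hfV n hg
    change ‖_‖ < ε at this
    rwa [norm_theta_smul] at this
  let c : Fin s.card → halfReal Z := fun n => halfReal.ofInvariant (m n) (orbitAverage_smul (f n))
  let b : halfReal Z := ∑ n, c n * i (e.symm n)
  have hb : Q.q b = 0 := by
    simp only [b, map_sum, map_mul, hi, mul_zero, Finset.sum_const_zero]
  have hab : a - b = ∑ n, c n * (a - i (e.symm n)) := by
    have hc : ∑ n, c n = 1 := by
      refine Subtype.ext (CrossedProduct.embedding_injective ?_)
      ext1 z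
      change theta z ((∑ n, c n : halfReal Z) : CrossedProduct Z) = theta z 1
      rw [AddSubmonoidClass.coe_finsetSum, map_sum, map_one]
      simp only [c, theta_ofInvariant]
      rw [← Finset.sum_smul, ← Complex.ofReal_sum, hm1, Complex.ofReal_one, one_smul]
    simp only [mul_sub, Finset.sum_sub_distrib, ← Finset.sum_mul, hc, one_mul, b]
  have hnorm : ‖a - b‖ ≤ ε := by
    refine norm_le_of_theta_le hε.le fun z => ?_
    rw [hab]
    change ‖theta z ((∑ n, c n * (a - i (e.symm n)) : halfReal Z) : CrossedProduct Z)‖ ≤ ε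
    rw [AddSubmonoidClass.coe_finsetSum, map_sum]
    calc ‖∑ n, theta z ((c n * (a - i (e.symm n)) : halfReal Z) : CrossedProduct Z)‖
        ≤ ∑ n, m n z * ε := by
          refine norm_sum_le_of_le _ fun n _ => ?_
          rw [theta_ofInvariant_mul, norm_smul, Complex.norm_of_nonneg (hm0 n z)]
          by_cases hz : z ∈ V (e.symm n : Z)
          · exact mul_le_mul_of_nonneg_left (le_of_lt hz) (hm0 n z)
          · rw [hmV n z hz, zero_mul, zero_mul]
      _ = ε := by rw [← Finset.sum_mul, hm1, one_mul]
  calc ‖Q.q a‖ = ‖Q.q (a - b)‖ := by rw [map_sub, hb, sub_zero]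
    _ ≤ ‖a - b‖ := NonUnitalStarAlgHom.norm_apply_le Q.q _
    _ ≤ ε := hnorm

/-- The image of the kernel is a nonzero two-sided ideal of the simple algebra M₂(ℂ). -/
theorem CStarQuotient.exists_theta_eq_of_regular (hfree : CircleFree Z)
    (Q : CStarQuotient (halfReal Z)) {z : Z} (hz : z ∈ regPoints Z) (hzE : z ∉ Q.regPart)
    (M : Matrix (Fin 2) (Fin 2) ℂ) :
    ∃ j : halfReal Z, Q.q j = 0 ∧ theta z (j : CrossedProduct Z) = M := by
  obtain ⟨i, hi, hne⟩ : ∃ i : halfReal Z, Q.q i = 0 ∧ theta z (i : CrossedProduct Z) ≠ 0 := by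
    by_contra! h
    exact hzE ⟨hz, h⟩
  obtain ⟨r, s, hrs⟩ : ∃ r s, theta z (i : CrossedProduct Z) r s ≠ 0 := by
    by_contra! h
    exact hne (by ext r s; exact h r s)
  -- With T = θ_z(i) and T_rs ≠ 0, the sum over k of E_kr T E_sk / T_rs is the identity.
  choose x hx using fun k : Fin 2 => exists_theta_eq hfree hz (Matrix.single k r 1)
  choose y hy using fun k : Fin 2 =>
    exists_theta_eq hfree hz (Matrix.single s k (theta z (i : CrossedProduct Z) r s)⁻¹)
  obtain ⟨m, hm⟩ := exists_theta_eq hfree hz M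
  refine ⟨(∑ k, x k * i * y k) * m, by simp [hi], ?_⟩
  change theta z (((∑ k, x k * i * y k : halfReal Z) : CrossedProduct Z) * m) = M
  have h1 : theta z ((∑ k, x k * i * y k : halfReal Z) : CrossedProduct Z) = 1 := by
    rw [AddSubmonoidClass.coe_finsetSum, map_sum]
    change ∑ k, theta z ((x k : CrossedProduct Z) * i * y k) = 1
    simp only [map_mul, hx, hy, Matrix.single_mul_mul_single, one_mul, mul_inv_cancel₀ hrs]
    ext p q
    fin_cases p <;> fin_cases q <;> simp
  rw [map_mul, h1, hm, one_mul]

/-- At a real z, θ_z amounts to the two numbers f₀(z) ± f₁(z), that is φ_z and φ_{-z}. `key` matches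
`a` at one of these characters with a kernel element that vanishes at the other; adding the results
for z and -z matches both. -/
theorem CStarQuotient.exists_theta_eq_of_real (hfree : CircleFree Z)
    (Q : CStarQuotient (halfReal Z)) {z : Z} (hz : z ∈ realPoints Z) (a : halfReal Z)
    (ha : ∀ (w : Z) (hw : w ∈ Q.realPart), phi ⟨w, hw.1⟩ (a : CrossedProduct Z) = 0) :
    ∃ j : halfReal Z, Q.q j = 0 ∧
      theta z (j : CrossedProduct Z) = theta z (a : CrossedProduct Z) := by
  have key (w : Z) (hw : w ∈ realPoints Z) : ∃ j : halfReal Z, Q.q j = 0 ∧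
      (j : CrossedProduct Z).f₀ w + (j : CrossedProduct Z).f₁ w =
        (a : CrossedProduct Z).f₀ w + (a : CrossedProduct Z).f₁ w ∧
      (j : CrossedProduct Z).f₀ w - (j : CrossedProduct Z).f₁ w = 0 := by
    have hw' : tauElt • w = w := hw
    by_cases hwF : w ∈ Q.realPart
    · refine ⟨0, map_zero _, ?_, by simp⟩
      have := ha w hwF
      rw [phi_apply] at this
      simp [this]
    · obtain ⟨i, hi, hne⟩ : ∃ i : halfReal Z, Q.q i = 0 ∧
          phi ⟨w, hw⟩ (i : CrossedProduct Z) ≠ 0 := by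
        by_contra! h
        exact hwF ⟨hw, h⟩
      rw [phi_apply] at hne
      let r := ((a : CrossedProduct Z).f₀ w + (a : CrossedProduct Z).f₁ w) /
        ((i : CrossedProduct Z).f₀ w + (i : CrossedProduct Z).f₁ w)
      have hr : r * ((i : CrossedProduct Z).f₀ w + (i : CrossedProduct Z).f₁ w) =
          (a : CrossedProduct Z).f₀ w + (a : CrossedProduct Z).f₁ w := div_mul_cancel₀ _ hne
      -- `p` has φ_w-value r and φ_{-w}-value 0.
      obtain ⟨p, hp0, hp1⟩ := exists_f₀_eq_f₁_eq hfree w (r / 2) (r / 2)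
      refine ⟨p * i, by simp [hi], ?_, ?_⟩
      · rw [← hr]
        change ((p : CrossedProduct Z) * i).f₀ w + ((p : CrossedProduct Z) * i).f₁ w = _
        simp [hp0, hp1, hw']
        ring
      · change ((p : CrossedProduct Z) * i).f₀ w - ((p : CrossedProduct Z) * i).f₁ w = _
        simp [hp0, hp1, hw']
        ring
  have ht : (Circle.exp Real.pi : ℂ) = -1 := by simp
  have hti : (Circle.exp Real.pi)⁻¹ = Circle.exp Real.pi := by
    ext
    simp
  obtain ⟨j, hj, hj1, hj2⟩ := key z hz
  obtain ⟨k, hk, hk1, hk2⟩ := key _ ((circleElt_smul_mem_realPoints_iff hti).2 hz)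
  simp only [halfReal.f₀_smul, halfReal.f₁_smul, ht] at hk1 hk2
  have hz' : tauElt • z = z := hz
  refine ⟨j + k, by simp [hj, hk], ?_⟩
  change theta z ((j : CrossedProduct Z) + k) = _
  have h0 : ((j : CrossedProduct Z) + k).f₀ z = (a : CrossedProduct Z).f₀ z := by
    simp only [add_f₀, ContinuousMap.add_apply]
    linear_combination (hj1 + hj2 + hk1 + hk2) / 2
  have h1 : ((j : CrossedProduct Z) + k).f₁ z = (a : CrossedProduct Z).f₁ z := by
    simp only [add_f₁, ContinuousMap.add_apply]
    linear_combination (hj1 - hj2 - hk1 + hk2) / 2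
  rw [theta_apply, theta_apply, hz', h0, h1]

/-- The kernel of a quotient is determined by its pair. -/
theorem CStarQuotient.map_eq_zero_iff (hfree : CircleFree Z)
    (Q : CStarQuotient (halfReal Z)) (a : halfReal Z) :
    Q.q a = 0 ↔ (∀ z ∈ Q.regPart, theta z (a : CrossedProduct Z) = 0) ∧
      ∀ (z : Z) (hz : z ∈ Q.realPart), phi ⟨z, hz.1⟩ (a : CrossedProduct Z) = 0 := by
  refine ⟨fun h => ⟨fun z hz => hz.2 a h, fun z hz => hz.2 a h⟩, fun ⟨hE, hF⟩ => ?_⟩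
  refine Q.eq_zero_of_fibers a fun z => ?_
  by_cases hz : z ∈ regPoints Z
  · by_cases hzE : z ∈ Q.regPart
    · exact ⟨0, map_zero _, by rw [hE z hzE, ZeroMemClass.coe_zero, map_zero]⟩
    · exact Q.exists_theta_eq_of_regular hfree hz hzE _
  · obtain ⟨t, y, hy, rfl⟩ := Set.notMem_compl_iff.1 hz
    obtain ⟨j, hj, hja⟩ := Q.exists_theta_eq_of_real hfree hy a hF
    exact ⟨j, hj, (theta_smul_eq_iff _ _ _ _).2 hja⟩

/-- A point of E makes M₂(ℂ) a quotient of the target. If E is empty, characters alone detect the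
kernel, and they kill commutators. -/
theorem CStarQuotient.not_classical_iff (hfree : CircleFree Z) (Q : CStarQuotient (halfReal Z)) :
    ¬ Q.Classical ↔ Q.regPart ≠ ∅ := by
  rw [← Set.nonempty_iff_ne_empty, ← not_iff_not, not_not, Set.not_nonempty_iff_eq_empty]
  constructor
  · refine fun hcl => Set.eq_empty_of_forall_notMem fun z hz => ?_
    obtain ⟨a, ha⟩ := exists_theta_eq hfree hz.1 (Matrix.single 0 0 1)
    obtain ⟨b, hb⟩ := exists_theta_eq hfree hz.1 (Matrix.single 0 1 1)
    have h := hz.2 (a * b - b * a) (by rw [map_sub, map_mul, map_mul, hcl, sub_self])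
    change theta z ((a : CrossedProduct Z) * b - b * a) = 0 at h
    rw [map_sub, map_mul, map_mul, ha, hb] at h
    simpa using congrFun (congrFun h 0) 1
  · intro hE x y
    obtain ⟨a, rfl⟩ := Q.surj x
    obtain ⟨b, rfl⟩ := Q.surj y
    rw [← sub_eq_zero, ← map_mul, ← map_mul, ← map_sub, Q.map_eq_zero_iff hfree, hE]
    refine ⟨fun z hz => hz.elim, fun z hz => ?_⟩
    change phi ⟨z, hz.1⟩ ((a : CrossedProduct Z) * b - b * a) = 0
    rw [map_sub, map_mul, map_mul, mul_comm, sub_self]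

/-- The pair of a quotient. -/
def CStarQuotient.toPair (Q : CStarQuotient (halfReal Z)) : SubspacePair Z where
  E := Q.regPart
  F := Q.realPart
  E_subset _ hz := hz.1
  E_stable g z hz := ⟨smul_mem_regPoints g hz.1, fun a ha =>
    (theta_smul_eq_zero_iff g z a).2 (hz.2 a ha)⟩
  E_closed := subset_antisymm (fun _ hz => ⟨subset_closure hz, hz.1⟩)
    fun _ hz => ⟨hz.2, Q.closure_regPart_subset hz.1⟩
  F_subset _ hz := hz.1
  F_closed := by
    have h : Q.realPart = realPoints Z ∩ {z | ∀ a : halfReal Z, Q.q a = 0 →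
        (a : CrossedProduct Z).f₀ z + (a : CrossedProduct Z).f₁ z = 0} := by
      ext z
      exact ⟨fun hz => ⟨hz.1, hz.2⟩, fun hz => ⟨hz.1, hz.2⟩⟩
    rw [h]
    refine isClosed_realPoints.inter ?_
    simp only [Set.ofPred_forall]
    exact isClosed_iInter fun a => isClosed_iInter fun _ =>
      isClosed_eq (by fun_prop) continuous_const
  closure_subset z hz := ⟨hz.2, fun a ha =>
    phi_eq_zero_of_theta_eq_zero ⟨z, hz.2⟩ (Q.closure_regPart_subset hz.1 a ha)⟩

end Fibers

/-! ### From a pair to a quotient. -/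

section Pairs

open scoped Matrix.Norms.L2Operator

variable {Z : Type u} [TopologicalSpace Z] [MulAction CircleZtwo Z] [ContinuousSMul CircleZtwo Z]

namespace SubspacePair

variable (P : SubspacePair Z)

/-- The restriction of `C(Z_{ℝ,*})` to the closure of `E` and to `F`. -/
noncomputable def restrict :
    halfReal Z →⋆ₐ[ℂ] C(closure P.E, Matrix (Fin 2) (Fin 2) ℂ) × C(P.F, ℂ) where
  toFun a := (⟨fun z => theta (z : Z) (a : CrossedProduct Z),
      (continuous_theta _).comp continuous_subtype_val⟩,
    ⟨fun y => phi ⟨(y : Z), P.F_subset y.2⟩ (a : CrossedProduct Z), by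
      simp only [phi_apply]; fun_prop⟩)
  map_one' := Prod.ext (ContinuousMap.ext fun z => map_one (theta (z : Z)))
    (ContinuousMap.ext fun y => map_one (phi ⟨(y : Z), P.F_subset y.2⟩))
  map_mul' a b := Prod.ext (ContinuousMap.ext fun z =>
      map_mul (theta (z : Z)) (a : CrossedProduct Z) b)
    (ContinuousMap.ext fun y => map_mul (phi ⟨(y : Z), P.F_subset y.2⟩) (a : CrossedProduct Z) b)
  map_zero' := Prod.ext (ContinuousMap.ext fun z => map_zero (theta (z : Z)))
    (ContinuousMap.ext fun y => map_zero (phi ⟨(y : Z), P.F_subset y.2⟩))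
  map_add' a b := Prod.ext (ContinuousMap.ext fun z =>
      map_add (theta (z : Z)) (a : CrossedProduct Z) b)
    (ContinuousMap.ext fun y => map_add (phi ⟨(y : Z), P.F_subset y.2⟩) (a : CrossedProduct Z) b)
  commutes' c := Prod.ext (ContinuousMap.ext fun z => AlgHomClass.commutes (theta (z : Z)) c)
    (ContinuousMap.ext fun y => AlgHomClass.commutes (phi ⟨(y : Z), P.F_subset y.2⟩) c)
  map_star' a := Prod.ext (ContinuousMap.ext fun z =>
      map_star (theta (z : Z)) (a : CrossedProduct Z))
    (ContinuousMap.ext fun y => map_star (phi ⟨(y : Z), P.F_subset y.2⟩) (a : CrossedProduct Z))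

theorem restrict_eq_zero_iff (a : halfReal Z) :
    P.restrict a = 0 ↔ (∀ z ∈ closure P.E, theta z (a : CrossedProduct Z) = 0) ∧
      ∀ (y : Z) (hy : y ∈ P.F), phi ⟨y, P.F_subset hy⟩ (a : CrossedProduct Z) = 0 := by
  constructor
  · intro h
    exact ⟨fun z hz => congrArg (fun p => p.1 ⟨z, hz⟩) h,
      fun y hy => congrArg (fun p => p.2 ⟨y, hy⟩) h⟩
  · rintro ⟨h1, h2⟩
    ext1 <;> ext1 z
    · exact h1 z z.2
    · exact h2 z z.2

theorem closure_stable (g : CircleZtwo) {z : Z} (hz : z ∈ closure P.E) : g • z ∈ closure P.E :=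
  map_mem_closure (continuous_const_smul g) hz fun y hy => P.E_stable g y hy

variable [CompactSpace Z]

/-- `restrict` uses closure E rather than E so that its target is a C*-algebra. -/
instance : CompactSpace (closure P.E) := isCompact_iff_compactSpace.1 isClosed_closure.isCompact

instance : CompactSpace P.F := isCompact_iff_compactSpace.1 P.F_closed.isCompact

/-- The quotient of `C(Z_{ℝ,*})` defined by a pair. -/
noncomputable def quotient : CStarQuotient (halfReal Z) := CStarQuotient.ofHom P.restrict

theorem quotient_eq_zero_iff (a : halfReal Z) :
    P.quotient.q a = 0 ↔ (∀ z ∈ closure P.E, theta z (a : CrossedProduct Z) = 0) ∧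
      ∀ (y : Z) (hy : y ∈ P.F), phi ⟨y, P.F_subset hy⟩ (a : CrossedProduct Z) = 0 :=
  (CStarQuotient.ofHom_eq_zero_iff _ _).trans (P.restrict_eq_zero_iff a)

variable [T2Space Z]

/-- For regular z outside E, take an invariant function equal to 1 at z and 0 on closure E and on 𝕋
Z_ℝ ⊇ F. It lies in the kernel, yet θ_z sends it to 1. -/
theorem regPart_quotient : P.quotient.regPart = P.E := by
  refine subset_antisymm (fun z hz => ?_) fun z hz => ⟨P.E_subset hz, fun a ha =>
    ((P.quotient_eq_zero_iff a).1 ha).1 z (subset_closure hz)⟩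
  by_contra hzE
  have hT := (isCompact_circleSaturation (isClosed_realPoints (Z := Z)).isCompact).isClosed
  obtain ⟨h, hinv, h0, h1, -⟩ := exists_invariant_zero_one (isClosed_closure.union hT) (z := z)
    (by
      rintro g y (hy | hy)
      · exact Or.inl (P.closure_stable g hy)
      · refine Or.inr (not_not.1 fun hg => ?_)
        have := smul_mem_regPoints g⁻¹ (z := g • y) hg
        rw [inv_smul_smul] at this
        exact this hy)
    (by
      rintro (hy | hy)
      · exact hzE (P.E_closed ▸ ⟨hy, hz.1⟩)
      · exact hz.1 hy)
  have hq : P.quotient.q (halfReal.ofInvariant h hinv) = 0 := by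
    rw [quotient_eq_zero_iff]
    have hθ (y : Z) (hy : h y = 0) :
        theta y (halfReal.ofInvariant h hinv : CrossedProduct Z) = 0 := by
      rw [theta_ofInvariant, hy, Complex.ofReal_zero, zero_smul]
    refine ⟨fun y hy => hθ y (h0 y (Or.inl hy)), fun y hy => ?_⟩
    exact phi_eq_zero_of_theta_eq_zero _
      (hθ y (h0 y (Or.inr ⟨1, y, P.F_subset hy, by rw [circleElt_one, one_smul]⟩)))
  have h2 := hz.2 _ hq
  rw [theta_ofInvariant, h1, Complex.ofReal_one, one_smul] at h2
  exact one_ne_zero h2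

/-- An invariant function cannot separate z from -z, so instead of an explicit kernel element a norm
estimate is used: were φ_z to kill the kernel, |φ_z(a)| would be at most the norm of the restriction
of a. -/
theorem realPart_quotient (hfree : CircleFree Z) : P.quotient.realPart = P.F := by
  refine subset_antisymm (fun z hz => ?_) fun z hz => ⟨P.F_subset hz, fun a ha =>
    ((P.quotient_eq_zero_iff a).1 ha).2 z hz⟩
  by_contra hzF
  obtain ⟨hzR, hz⟩ := hz
  have hzτ : tauElt • z = z := hzR
  -- φ_z(b) = 1 and φ_{-z}(b) = 0. By freeness z and -z are the only real points of 𝕋z, so `N`, the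
  -- part of F where b is large, misses the orbit of z even when -z ∈ F.
  obtain ⟨b, hb0, hb1⟩ := exists_f₀_eq_f₁_eq hfree z (1 / 2) (1 / 2)
  let N : Set Z := P.F ∩ {y | 1 / 2 ≤ ‖(b : CrossedProduct Z).f₀ y + (b : CrossedProduct Z).f₁ y‖}
  have hN : IsClosed N := P.F_closed.inter (isClosed_le continuous_const (by fun_prop))
  have hGN := (isCompact_saturation hN.isCompact).isClosed
  have hzN : ∀ t : Circle, circleElt t • z ∉ N := by
    intro t ht
    have htR : tauElt • circleElt t • z = circleElt t • z := P.F_subset ht.1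
    rw [tau_smul_circle_smul, hzτ] at htR
    have htt : circleElt (t * t) • z = z := by
      rw [circleElt_mul, mul_smul, ← htR, smul_smul, ← circleElt_mul, mul_inv_cancel,
        circleElt_one, one_smul]
    have ht1 : (t : ℂ) * t = 1 := by
      rw [← Circle.coe_mul, hfree _ _ htt, Circle.coe_one]
    rcases mul_self_eq_one_iff.1 ht1 with h | h
    · have : t = 1 := Circle.ext h
      rw [this, circleElt_one, one_smul] at ht
      exact hzF ht.1
    · have := ht.2
      rw [Set.mem_ofPred_eq, hb0, halfReal.f₁_smul, hb1, h] at this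
      norm_num at this
  obtain ⟨h, hinv, h0, h1, h01⟩ := exists_invariant_zero_one (isClosed_closure.union hGN) (z := z)
    (by
      rintro g y (hy | ⟨k, x, hx, rfl⟩)
      · exact Or.inl (P.closure_stable g hy)
      · exact Or.inr ⟨g * k, x, hx, smul_smul _ _ _⟩)
    (by
      rintro (hy | ⟨g, y, hy, hg⟩)
      · exact hzF (P.closure_subset ⟨hy, hzR⟩)
      · have hgy : y = g⁻¹ • z := by rw [hg, inv_smul_smul]
        rcases g⁻¹.eq_circleElt_or with h | h
        · exact hzN _ (h ▸ hgy ▸ hy)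
        · refine hzN (g⁻¹).left ?_
          rw [h, mul_smul, hzτ] at hgy
          exact hgy ▸ hy)
  let a := halfReal.ofInvariant h hinv * b
  have hπ : ‖P.restrict a‖ ≤ 1 / 2 := by
    refine max_le ((ContinuousMap.norm_le _ (by norm_num)).2 fun y => ?_)
      ((ContinuousMap.norm_le _ (by norm_num)).2 fun y => ?_)
    · change ‖theta (y : Z) (a : CrossedProduct Z)‖ ≤ _
      rw [theta_ofInvariant_mul, h0 y (Or.inl y.2), Complex.ofReal_zero, zero_smul, norm_zero]
      norm_num
    · change ‖phi ⟨(y : Z), P.F_subset y.2⟩ (a : CrossedProduct Z)‖ ≤ _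
      rw [phi_ofInvariant_mul, norm_mul, Complex.norm_of_nonneg (h01 _).1, phi_apply]
      by_cases hy : (y : Z) ∈ N
      · change h (y : Z) * _ ≤ _
        rw [h0 y (Or.inr ⟨1, y, hy, by rw [one_smul]⟩), zero_mul]
        norm_num
      · have hy' : ‖(b : CrossedProduct Z).f₀ y + (b : CrossedProduct Z).f₁ y‖ ≤ 1 / 2 :=
          le_of_not_ge fun hle => hy ⟨y.2, hle⟩
        exact (mul_le_of_le_one_left (norm_nonneg _) (h01 _).2).trans hy'
  -- `a' - a` is in the kernel, so φ_z(a') = φ_z(a) = 1, against ‖a'‖ ≤ 1/2.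
  obtain ⟨a', ha', hn⟩ := P.restrict.exists_norm_le_preimage a
  have hker : P.quotient.q (a' - a) = 0 :=
    (CStarQuotient.ofHom_eq_zero_iff _ _).2 (by rw [map_sub, ha', sub_self])
  have hφ := hz _ hker
  change phi ⟨z, hzR⟩ ((a' : CrossedProduct Z) - a) = 0 at hφ
  rw [map_sub, sub_eq_zero, phi_ofInvariant_mul, phi_apply ⟨z, hzR⟩ (b : CrossedProduct Z)] at hφ
  have hle : ‖phi ⟨z, hzR⟩ (a' : CrossedProduct Z)‖ ≤ ‖(a' : CrossedProduct Z)‖ :=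
    NonUnitalStarAlgHom.norm_apply_le (phi ⟨z, hzR⟩) _
  rw [hφ] at hle
  change ‖(h z : ℂ) * ((b : CrossedProduct Z).f₀ z + (b : CrossedProduct Z).f₁ z)‖ ≤ ‖a'‖ at hle
  rw [h1, hb0, hb1] at hle
  norm_num at hle hπ hn
  linarith

end SubspacePair

end Pairs

/-! ### The bijection. -/

theorem mainTheorem1 (Z : Type u) [TopologicalSpace Z] [CompactSpace Z] [T2Space Z]
    [MulAction CircleZtwo Z] [ContinuousSMul CircleZtwo Z] (hfree : CircleFree Z) :
    ∃ Φ : QuantumSubspace (halfReal Z) ≃ SubspacePair Z,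
      (∀ Q : CStarQuotient (halfReal Z),
        (Φ Q.toSubspace).E =
          {z | z ∈ regPoints Z ∧
            ∀ a : halfReal Z, Q.q a = 0 → CrossedProduct.theta z (a : CrossedProduct Z) = 0} ∧
        (Φ Q.toSubspace).F =
          {z | ∃ hz : z ∈ realPoints Z,
            ∀ a : halfReal Z, Q.q a = 0 → CrossedProduct.phi ⟨z, hz⟩ (a : CrossedProduct Z) = 0}) ∧
      ∀ X : QuantumSubspace (halfReal Z), ¬ X.Classical ↔ (Φ X).E ≠ ∅ := by
  let φ : QuantumSubspace (halfReal Z) → SubspacePair Z :=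
    Quotient.lift CStarQuotient.toPair fun Q Q' h => by
      have hk := CStarQuotient.map_eq_zero_iff_of_equiv h
      ext z
      · simp only [CStarQuotient.toPair, CStarQuotient.regPart, hk]
      · simp only [CStarQuotient.toPair, CStarQuotient.realPart, hk]
  have hφ : Function.Bijective φ := by
    constructor
    · intro X X' h
      induction X using Quotient.inductionOn with | _ Q
      induction X' using Quotient.inductionOn with | _ Q'
      have hE : Q.regPart = Q'.regPart := congrArg SubspacePair.E h
      have hF : Q.realPart = Q'.realPart := congrArg SubspacePair.F h
      refine CStarQuotient.toSubspace_eq fun a => ?_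
      rw [Q.map_eq_zero_iff hfree, Q'.map_eq_zero_iff hfree]
      simp only [hE, hF]
    · intro P
      exact ⟨P.quotient.toSubspace,
        SubspacePair.ext P.regPart_quotient (P.realPart_quotient hfree)⟩
  refine ⟨Equiv.ofBijective φ hφ, fun Q => ⟨rfl, rfl⟩, fun X => ?_⟩
  induction X using Quotient.inductionOn with | _ Q
  exact Q.not_classical_iff hfree
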